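/- Let $N\ge 1$, $A\in\mathbb{R}\setminus\{0\}$, $B\in\mathbb{R}$. For $j\in\{1,\dots,N\}$ let $p_0^{(j)},q_0^{(j)}\in\mathbb{R}$ with $|p_0^{(j)}q_0^{(j)}|<1$ and let $\Phi_j\in L^2(\mathbb{R})$ be non-zero. For $n,l\in\mathbb{Z}$ put $$\Phi^{A,B}_{(n,l,j)}(x)=e^{2\pi i\left[\frac12 A n l p_0^{(j)}q_0^{(j)}+B l p_0^{(j)}\right]}\,e^{2\pi i A l p_0^{(j)}x}\,\Phi_j\big(x+nq_0^{(j)}\big),$$ and let $\widehat{\ }$ be the Fourier transform on $L^2(\mathbb{R})$ with kernel $e^{-2\pi i x\gamma}$. Suppose that $\{\Phi^{A,B}_{(n,l,j)}\}_{n,l\in\mathbb{Z},\,1\le j\le N}$ is a frame sequence, i.e. a frame of its closed linear span in $L^2(\mathbb{R})$. Then $f\in L^2(\mathbb{R})$ lies in $\overline{\mathrm{span}}\{\Phi^{A,B}_{(n,l,j)}\}_{n,l\in\mathbb{Z},\,1\le j\le N}$ if and only if there are $1$-periodic functions $F_{l,j}:\mathbb{R}\to\mathbb{C}$ ($l\in\mathbb{Z}$,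 $1\le j\le N$), whose restrictions to $[0,1)$ belong to $L^2([0,1))$, such that $$\widehat f(\gamma)=\sum_{j=1}^N\sum_{l\in\mathbb{Z}}F_{l,j}\big(q_0^{(j)}\gamma\big)\,\widehat{\Phi_j}\big(\gamma-Alp_0^{(j)}\big),$$ where the terms belong to $L^2(\mathbb{R})$ and, for each $j$, the series over $l$ converges unconditionally in $L^2(\mathbb{R})$. -/

import Mathlib

open MeasureTheory
open scoped FourierTransform ENNReal

/-- The closed linear span of a family of vectors of a complex Hilbert space. -/
def closedSpan {H ι : Type*} [NormedAddCommGroup H] [InnerProductSpace ℂ H] (φ : ι → H) :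
    Submodule ℂ H :=
  (Submodule.span ℂ (Set.range φ)).topologicalClosure

theorem mem_closedSpan {H ι : Type*} [NormedAddCommGroup H] [InnerProductSpace ℂ H]
    (φ : ι → H) (k : ι) : φ k ∈ closedSpan φ :=
  Submodule.le_topologicalClosure _ (Submodule.subset_span ⟨k, rfl⟩)

/-- The family `φ` is a frame of the Hilbert space `H`: for some `0 < α` and `0 < β`,
`α ‖f‖² ≤ ∑ₖ |⟨f, φₖ⟩|² ≤ β ‖f‖²` for all `f` in `H` (the series being convergent). -/
def IsFrame {H ι : Type*} [NormedAddCommGroup H] [InnerProductSpace ℂ H] (φ : ι → H) : Prop :=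
  ∃ α β : ℝ, 0 < α ∧ 0 < β ∧ ∀ f : H,
    Summable (fun k => ‖inner ℂ (φ k) f‖ ^ 2) ∧
    α * ‖f‖ ^ 2 ≤ ∑' k, ‖inner ℂ (φ k) f‖ ^ 2 ∧
    ∑' k, ‖inner ℂ (φ k) f‖ ^ 2 ≤ β * ‖f‖ ^ 2

/-- A frame sequence is a family that is a frame of its closed linear span. -/
def IsFrameSequence {H ι : Type*} [NormedAddCommGroup H] [InnerProductSpace ℂ H]
    (φ : ι → H) : Prop :=
  IsFrame (fun k => (⟨φ k, mem_closedSpan φ k⟩ : closedSpan φ))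

theorem memLp_weylHeisenberg (A B c y₁ y₂ : ℝ) (f : Lp ℂ 2 (volume : Measure ℝ)) :
    MemLp (fun x : ℝ =>
      Complex.exp (2 * Real.pi * Complex.I * ((A * (y₁ + x * y₂) + B * y₂ : ℝ) : ℂ)) * f (c + x))
      2 volume := by
  have h : MemLp (fun x : ℝ => f (c + x)) 2 volume :=
    (Lp.memLp f).comp_measurePreserving (measurePreserving_add_left volume c)
  refine h.congr_norm ?_ (Filter.Eventually.of_forall fun x => ?_)
  · exact (Continuous.aestronglyMeasurable (by fun_prop)).mul h.aestronglyMeasurable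
  · have : (2 * Real.pi * Complex.I * ((A * (y₁ + x * y₂) + B * y₂ : ℝ) : ℂ)) =
        ((2 * Real.pi * (A * (y₁ + x * y₂) + B * y₂) : ℝ) : ℂ) * Complex.I := by
      push_cast; ring
    rw [this, norm_mul, Complex.norm_exp_ofReal_mul_I, one_mul]

/-- The operator `Θ^{A,B}(c, (y₁, y₂))` of the representation of the Weyl--Heisenberg group on
`L²(ℝ)`: `(Θ^{A,B}(c, (y₁, y₂)) f)(x) = exp(2πi [A (y₁ + x y₂) + B y₂]) f(c + x)`. -/
noncomputable def weylHeisenberg (A B c y₁ y₂ : ℝ) (f : Lp ℂ 2 (volume : Measure ℝ)) :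
    Lp ℂ 2 (volume : Measure ℝ) :=
  (memLp_weylHeisenberg A B c y₁ y₂ f).toLp _

/-- The Gabor system `Φ^{A,B}_{(n,l,j)} = Θ^{A,B}(n q_j, (n l q_j p_j / 2, l p_j)) Φ_j`, indexed by
the triples `(n, l, j)`. -/
noncomputable def gaborSystem {N : ℕ} (A B : ℝ) (p q : Fin N → ℝ)
    (Φ : Fin N → Lp ℂ 2 (volume : Measure ℝ)) (k : ℤ × ℤ × Fin N) :
    Lp ℂ 2 (volume : Measure ℝ) :=
  weylHeisenberg A B (k.1 * q k.2.2) (k.1 * k.2.1 * q k.2.2 * p k.2.2 / 2) (k.2.1 * p k.2.2)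
    (Φ k.2.2)

/-- The functions `u i` on `ℝ` belong to `L²(ℝ)` and the series `∑ᵢ u i` converges
(unconditionally) in `L²(ℝ)` to `g`. -/
def HasL2Sum {ι : Type*} (u : ι → ℝ → ℂ) (g : Lp ℂ 2 (volume : Measure ℝ)) : Prop :=
  ∃ v : ι → Lp ℂ 2 (volume : Measure ℝ), (∀ i, v i =ᵐ[volume] u i) ∧ HasSum v g

/-! Up to unimodular constants, the Fourier transform sends the Gabor vectors to `exp(2πi n q_j γ)
Φ̂_j(γ - A l p_j)`. For fixed `l, j`, a series over `n` with square-summable coefficients is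
therefore a Fourier series in `q_j γ` times a fixed translate: it equals `F(q_j γ) Φ̂_j(γ - A l
p_j)` (`modulation_series_eq`).

If `f` lies in the closed span, the surjective synthesis operator of the frame writes it as an
unconditional series with `ℓ²` coefficients. Summing over `n` first, then `l`, then `j` gives the
expansion (`exists_periodic_expansion`). Conversely, the closed span is closed under limits, so it
is enough that each single term is the transform of one of its elements. It is, since the Fourier
coefficients of `F` are square summable (`exists_mem_closedSpan_fourier`); no joint `ℓ²` bound over
`l` is needed. -/

/-! ### Frames and their synthesis operators -/

section Frames

open scoped lp InnerProductSpace
open ContinuousLinearMap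

variable {H ι : Type*} [NormedAddCommGroup H] [InnerProductSpace ℂ H]

/-- The analysis operator `f ↦ (⟨φₖ, f⟩)ₖ` of a Bessel family. -/
theorem exists_analysis_operator {φ : ι → H} {β : ℝ} (hβ : 0 < β)
    (h : ∀ f : H, Summable (fun k => ‖inner ℂ (φ k) f‖ ^ 2) ∧
      ∑' k, ‖inner ℂ (φ k) f‖ ^ 2 ≤ β * ‖f‖ ^ 2) :
    ∃ C : H →L[ℂ] ℓ²(ι, ℂ), ∀ f k, C f k = inner ℂ (φ k) f := by
  have hmem : ∀ f : H, Memℓp (fun k => inner ℂ (φ k) f) 2 := fun f => by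
    refine (memℓp_gen_iff (by simp)).2 ?_
    simpa using (h f).1
  let C₀ : H →ₗ[ℂ] ℓ²(ι, ℂ) :=
    { toFun := fun f => ⟨fun k => inner ℂ (φ k) f, hmem f⟩
      map_add' := fun f g => by ext k; exact inner_add_right _ _ _
      map_smul' := fun c f => by ext k; exact inner_smul_right _ _ _ }
  refine ⟨C₀.mkContinuous (Real.sqrt β) fun f => ?_, fun f k => rfl⟩
  refine abs_le_of_sq_le_sq' ?_ (by positivity) |>.2
  rw [mul_pow, Real.sq_sqrt hβ.le]
  have := lp.norm_rpow_eq_tsum (p := 2) (by simp) (C₀ f)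
  simp only [ENNReal.toReal_ofNat, Real.rpow_ofNat] at this
  rw [this]
  exact (h f).2

/-- A frame has a surjective synthesis operator `c ↦ ∑ₖ cₖ φₖ`. -/
theorem IsFrame.exists_synthesis_operator [CompleteSpace H] [DecidableEq ι] {φ : ι → H} (hφ : IsFrame φ) :
    ∃ T : ℓ²(ι, ℂ) →L[ℂ] H, (∀ k, T (lp.single 2 k 1) = φ k) ∧ Function.Surjective T := by
  obtain ⟨α, β, hα, hβ, h⟩ := hφ
  obtain ⟨C, hC⟩ := exists_analysis_operator hβ fun f => ⟨(h f).1, (h f).2.2⟩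
  refine ⟨adjoint C, fun k => ?_, ?_⟩
  · refine ext_inner_right ℂ fun f => ?_
    rw [adjoint_inner_left, lp.inner_single_left, hC]
    simp
  have hlower : ∀ f : H, α * ‖f‖ ^ 2 ≤ ‖C f‖ ^ 2 := fun f => by
    have := lp.norm_rpow_eq_tsum (p := 2) (by simp) (C f)
    simp only [ENNReal.toReal_ofNat, Real.rpow_ofNat, hC] at this
    rw [this]
    exact (h f).2.1
  -- The frame operator is self-adjoint and bounded below, so its range is closed with trivial
  -- orthogonal complement. Hence `S` is onto, and so is `adjoint C`.
  set S : H →L[ℂ] H := adjoint C ∘L C with hS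
  have hbound : ∀ f : H, α * ‖f‖ ≤ ‖S f‖ := fun f => by
    rcases eq_or_ne f 0 with rfl | hf
    · simp
    have h1 : ‖C f‖ ^ 2 ≤ ‖S f‖ * ‖f‖ := by
      have h2 : inner ℂ (S f) f = inner ℂ (C f) (C f) := by
        rw [hS, comp_apply, adjoint_inner_left]
      have h3 : ‖inner ℂ (C f) (C f)‖ = ‖C f‖ ^ 2 := by
        rw [inner_self_eq_norm_sq_to_K]; simp
      rw [← h3, ← h2]
      exact norm_inner_le_norm _ _
    have h4 := (hlower f).trans h1
    have h5 : 0 < ‖f‖ := norm_pos_iff.2 hf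
    nlinarith
  have hanti : AntilipschitzWith (Real.toNNReal α⁻¹) S :=
    AddMonoidHomClass.antilipschitz_of_bound S fun f => by
      rw [Real.coe_toNNReal _ (inv_pos.2 hα).le, inv_mul_eq_div, le_div_iff₀ hα, mul_comm]
      exact hbound f
  have hclosed : IsClosed (S.range : Set H) := by
    rw [LinearMap.coe_range]
    exact hanti.isClosed_range S.uniformContinuous
  have hker : S.ker = ⊥ := LinearMap.ker_eq_bot.2 hanti.injective
  have hadj : adjoint S = S := by rw [hS, adjoint_comp, adjoint_adjoint]
  have hrange : S.range = ⊤ := by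
    have : CompleteSpace S.range := hclosed.completeSpace_coe
    rw [← Submodule.orthogonal_eq_bot_iff, S.orthogonal_range, hadj, hker]
  intro f
  obtain ⟨g, hg⟩ := LinearMap.range_eq_top.1 hrange f
  exact ⟨C g, hg⟩

/-- A frame sequence has a synthesis operator `c ↦ ∑ₖ cₖ φₖ` onto its closed linear span. -/
theorem IsFrameSequence.exists_synthesis_operator [CompleteSpace H] [DecidableEq ι] {φ : ι → H}
    (hφ : IsFrameSequence φ) :
    ∃ T : ℓ²(ι, ℂ) →L[ℂ] H, (∀ k, T (lp.single 2 k 1) = φ k) ∧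
      ∀ f, f ∈ closedSpan φ ↔ ∃ c, T c = f := by
  have : CompleteSpace (closedSpan φ) :=
    (Submodule.isClosed_topologicalClosure _).completeSpace_coe
  obtain ⟨T, hT, hsurj⟩ := IsFrame.exists_synthesis_operator hφ
  refine ⟨(closedSpan φ).subtypeL ∘L T, fun k => by simp [hT], fun f => ⟨fun hf => ?_, ?_⟩⟩
  · obtain ⟨c, hc⟩ := hsurj ⟨f, hf⟩
    exact ⟨c, by simp [hc]⟩
  · rintro ⟨c, rfl⟩
    exact (T c).2

/-- The series of a synthesis operator. -/
theorem hasSum_synthesis [DecidableEq ι] {φ : ι → H} {T : ℓ²(ι, ℂ) →L[ℂ] H}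
    (hT : ∀ k, T (lp.single 2 k 1) = φ k) (c : ℓ²(ι, ℂ)) : HasSum (fun k => c k • φ k) (T c) := by
  have := (lp.hasSum_single (by simp) c).mapL T
  convert! this using 2 with k
  rw [← hT, ← map_smul, ← lp.single_smul]
  simp

/-- In a frame sequence no nonzero vector occurs infinitely often. -/
theorem IsFrameSequence.eq_zero_of_constant {φ : ι → H} (hφ : IsFrameSequence φ) {e : ℕ → ι}
    (he : Function.Injective e) {x : H} (hx : ∀ n, φ (e n) = x) : x = 0 := by
  obtain ⟨α, β, -, -, h⟩ := hφ
  -- Testing the frame sum on `x` itself gives a summable constant sequence with value a power of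
  -- `‖x‖`.
  have := ((h ⟨x, hx 0 ▸ mem_closedSpan φ (e 0)⟩).1.comp_injective he)
  simp only [Function.comp_def, Submodule.coe_inner, hx, summable_const_iff] at this
  simpa using this

/-- Extending the coefficients by zero outside the range of `e` keeps them in `ℓ²`, so the synthesis
operator of the whole family applies. -/
theorem IsFrameSequence.exists_hasSum_comp_injective [CompleteSpace H] {κ : Type*} {φ : ι → H}
    (hφ : IsFrameSequence φ) {e : κ → ι} (he : Function.Injective e) {d : κ → ℂ}
    (hd : Memℓp d 2) : ∃ g ∈ closedSpan φ, HasSum (fun k => d k • φ (e k)) g := by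
  classical
  obtain ⟨T, hT, hspan⟩ := hφ.exists_synthesis_operator
  have hc : Memℓp (E := fun _ : ι => ℂ) (Function.extend e d 0) 2 := by
    rw [memℓp_gen_iff (by simp)] at hd ⊢
    refine (he.summable_iff fun k hk => ?_).1 ?_
    · rw [Function.extend_apply' _ _ _ hk]; simp
    · simpa only [Function.comp_def, he.extend_apply] using hd
  refine ⟨T ⟨_, hc⟩, (hspan _).2 ⟨_, rfl⟩, ?_⟩
  have h := hasSum_synthesis hT ⟨_, hc⟩
  rw [← he.hasSum_iff] at h
  · simpa only [Function.comp_def, he.extend_apply] using h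
  · intro k hk
    simp only [Function.extend_apply' _ _ _ hk, Pi.zero_apply, zero_smul]

theorem LinearIsometryEquiv.mem_of_apply_eq_sum_of_hasSum {H' κ : Type*} [NormedAddCommGroup H']
    [InnerProductSpace ℂ H'] [Fintype κ] (U : H ≃ₗᵢ[ℂ] H') {V : Submodule ℂ H}
    (hV : IsClosed (V : Set H)) {f : H} {g : κ → H'} (hf : U f = ∑ j, g j)
    (hg : ∀ j, ∃ v : ι → H', (∀ l, ∃ h ∈ V, U h = v l) ∧ HasSum v (g j)) : f ∈ V := by
  let K : Submodule ℂ H' := V.comap U.symm.toLinearEquiv.toLinearMap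
  have hK : IsClosed (K : Set H') := hV.preimage U.symm.continuous
  have hmem : ∀ h, U h ∈ K ↔ h ∈ V := fun h => by
    change U.symm (U h) ∈ V ↔ _
    rw [U.symm_apply_apply]
  rw [← hmem, hf]
  refine K.sum_mem fun j _ => ?_
  obtain ⟨v, hv, hsum⟩ := hg j
  refine hK.mem_of_tendsto hsum (Filter.Eventually.of_forall fun s => K.sum_mem fun l _ => ?_)
  obtain ⟨h, hh, hhl⟩ := hv l
  rw [← hhl, hmem]
  exact hh

end Frames

/-! ### Translations, modulations and the Fourier transform -/

section WeylHeisenberg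

theorem coeFn_weylHeisenberg (A B c y₁ y₂ : ℝ) (f : Lp ℂ 2 (volume : Measure ℝ)) :
    weylHeisenberg A B c y₁ y₂ f =ᵐ[volume] fun x : ℝ =>
      Complex.exp (2 * Real.pi * Complex.I * ((A * (y₁ + x * y₂) + B * y₂ : ℝ) : ℂ)) * f (c + x) :=
  MemLp.coeFn_toLp _

theorem ae_add_left {P : ℝ → Prop} (h : ∀ᵐ x, P x) (c : ℝ) : ∀ᵐ x, P (c + x) :=
  (measurePreserving_add_left volume c).quasiMeasurePreserving.ae h

/-- The translation `f ↦ f (c + ·)` of `L²(ℝ)`. -/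
noncomputable def translation (c : ℝ) :
    Lp ℂ 2 (volume : Measure ℝ) →L[ℂ] Lp ℂ 2 (volume : Measure ℝ) :=
  (Lp.compMeasurePreservingₗᵢ ℂ (fun x => c + x)
    (measurePreserving_add_left volume c)).toContinuousLinearMap

theorem coeFn_translation (c : ℝ) (f : Lp ℂ 2 (volume : Measure ℝ)) :
    translation c f =ᵐ[volume] fun x => f (c + x) :=
  Lp.coeFn_compMeasurePreserving f (measurePreserving_add_left volume c)

/-- The modulation of `L²(ℝ)` by the character `x ↦ exp (2πi a x)`. -/
noncomputable def modulation (a : ℝ) :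
    Lp ℂ 2 (volume : Measure ℝ) →L[ℂ] Lp ℂ 2 (volume : Measure ℝ) :=
  LinearMap.mkContinuous
    { toFun := fun f => weylHeisenberg 1 0 0 0 a f
      map_add' := fun f g => by
        apply Lp.ext
        filter_upwards [coeFn_weylHeisenberg 1 0 0 0 a (f + g), coeFn_weylHeisenberg 1 0 0 0 a f,
          coeFn_weylHeisenberg 1 0 0 0 a g, Lp.coeFn_add f g,
          Lp.coeFn_add (weylHeisenberg 1 0 0 0 a f) (weylHeisenberg 1 0 0 0 a g)]
          with x h1 h2 h3 h4 h5
        rw [h1, h5, Pi.add_apply, h2, h3]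
        simp only [zero_add, h4, Pi.add_apply]
        ring
      map_smul' := fun r f => by
        apply Lp.ext
        filter_upwards [coeFn_weylHeisenberg 1 0 0 0 a (r • f), coeFn_weylHeisenberg 1 0 0 0 a f,
          Lp.coeFn_smul r f, Lp.coeFn_smul r (weylHeisenberg 1 0 0 0 a f)] with x h1 h2 h3 h4
        rw [h1, RingHom.id_apply, h4, Pi.smul_apply, h2]
        simp only [zero_add, h3, Pi.smul_apply, smul_eq_mul]
        ring } 1 fun f => by
    rw [one_mul]
    refine Lp.norm_le_norm_of_ae_le ?_
    filter_upwards [coeFn_weylHeisenberg 1 0 0 0 a f] with x h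
    simp only [LinearMap.coe_mk, AddHom.coe_mk]
    rw [h, norm_mul, mul_right_comm, ← Complex.ofReal_ofNat, ← Complex.ofReal_mul,
      ← Complex.ofReal_mul, Complex.norm_exp_ofReal_mul_I]
    simp

theorem coeFn_modulation (a : ℝ) (f : Lp ℂ 2 (volume : Measure ℝ)) :
    modulation a f =ᵐ[volume] fun x : ℝ =>
      Complex.exp (2 * Real.pi * Complex.I * ((a * x : ℝ) : ℂ)) * f x := by
  filter_upwards [coeFn_weylHeisenberg 1 0 0 0 a f] with x h
  refine h.trans ?_
  simp [mul_comm a]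

/-- The Fourier transform turns translations of Schwartz functions into modulations. -/
theorem SchwartzMap.fourier_comp_add_left (f : SchwartzMap ℝ ℂ) (c γ : ℝ) :
    𝓕 (f.compSubConstCLM ℂ (-c)) γ =
      Complex.exp (2 * Real.pi * Complex.I * ((c * γ : ℝ) : ℂ)) * 𝓕 f γ := by
  simp only [SchwartzMap.fourier_coe]
  have h : (f.compSubConstCLM ℂ (-c) : ℝ → ℂ) = (f : ℝ → ℂ) ∘ fun v => v + c := by
    ext v; simp
  rw [h]
  have := congrFun (VectorFourier.fourierIntegral_comp_add_right Real.fourierChar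
    (volume : Measure ℝ) (innerₗ ℝ) (f : ℝ → ℂ) c) γ
  refine this.trans ?_
  rw [Circle.smul_def, Real.fourierChar_apply, smul_eq_mul]
  congr 2
  simp
  ring

theorem SchwartzMap.fourierInv_comp_add_left (f : SchwartzMap ℝ ℂ) (c γ : ℝ) :
    𝓕⁻ (f.compSubConstCLM ℂ (-c)) γ =
      Complex.exp (2 * Real.pi * Complex.I * ((-c * γ : ℝ) : ℂ)) * 𝓕⁻ f γ := by
  have h := SchwartzMap.fourier_comp_add_left f c (-γ)
  simp only [SchwartzMap.fourier_coe, SchwartzMap.fourierInv_coe,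
    Real.fourierInv_eq_fourier_neg] at h ⊢
  rw [h]
  simp

theorem translation_toLp (f : SchwartzMap ℝ ℂ) (c : ℝ) :
    translation c (f.toLp 2) = (f.compSubConstCLM ℂ (-c)).toLp 2 := by
  apply Lp.ext
  filter_upwards [coeFn_translation c (f.toLp 2), ae_add_left (f.coeFn_toLp 2 volume) c,
    (f.compSubConstCLM ℂ (-c)).coeFn_toLp 2] with x h1 h2 h3
  rw [h1, h2, h3]
  simp [add_comm]

/-- Both sides are continuous in `f`, so density reduces this to Schwartz functions, where the
integral formula holds. -/
theorem fourier_translation (c : ℝ) (f : Lp ℂ 2 (volume : Measure ℝ)) :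
    𝓕 (translation c f) = modulation c (𝓕 f) := by
  refine DenseRange.induction_on (SchwartzMap.denseRange_toLpCLM (p := 2) (E := ℝ) (F := ℂ)
    (μ := volume) ENNReal.ofNat_ne_top) f ?_ fun g => ?_
  · exact isClosed_eq
      ((Lp.fourierTransformₗᵢ ℝ ℂ).continuous.comp (translation c).continuous)
      ((modulation c).continuous.comp (Lp.fourierTransformₗᵢ ℝ ℂ).continuous)
  · rw [SchwartzMap.toLpCLM_apply, translation_toLp, SchwartzMap.toLp_fourier_eq,
      SchwartzMap.toLp_fourier_eq]
    apply Lp.ext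
    filter_upwards [(𝓕 (g.compSubConstCLM ℂ (-c))).coeFn_toLp 2, (𝓕 g).coeFn_toLp 2,
      coeFn_modulation c ((𝓕 g).toLp 2)] with x h1 h2 h3
    rw [h1, h3, h2, SchwartzMap.fourier_comp_add_left]

theorem fourierInv_translation (c : ℝ) (f : Lp ℂ 2 (volume : Measure ℝ)) :
    𝓕⁻ (translation c f) = modulation (-c) (𝓕⁻ f) := by
  refine DenseRange.induction_on (SchwartzMap.denseRange_toLpCLM (p := 2) (E := ℝ) (F := ℂ)
    (μ := volume) ENNReal.ofNat_ne_top) f ?_ fun g => ?_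
  · exact isClosed_eq
      ((Lp.fourierTransformₗᵢ ℝ ℂ).symm.continuous.comp (translation c).continuous)
      ((modulation (-c)).continuous.comp (Lp.fourierTransformₗᵢ ℝ ℂ).symm.continuous)
  · rw [SchwartzMap.toLpCLM_apply, translation_toLp, SchwartzMap.toLp_fourierInv_eq,
      SchwartzMap.toLp_fourierInv_eq]
    apply Lp.ext
    filter_upwards [(𝓕⁻ (g.compSubConstCLM ℂ (-c))).coeFn_toLp 2, (𝓕⁻ g).coeFn_toLp 2,
      coeFn_modulation (-c) ((𝓕⁻ g).toLp 2)] with x h1 h2 h3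
    rw [h1, h3, h2, SchwartzMap.fourierInv_comp_add_left]

theorem fourier_modulation (a : ℝ) (f : Lp ℂ 2 (volume : Measure ℝ)) :
    𝓕 (modulation a f) = translation (-a) (𝓕 f) := by
  have h := fourierInv_translation (-a) (𝓕 f)
  rw [neg_neg, FourierTransform.fourierInv_fourier_eq] at h
  rw [← h, FourierTransform.fourier_fourierInv_eq]

theorem weylHeisenberg_eq (A B c y₁ y₂ : ℝ) (f : Lp ℂ 2 (volume : Measure ℝ)) :
    weylHeisenberg A B c y₁ y₂ f =
      Complex.exp (2 * Real.pi * Complex.I * ((A * y₁ + B * y₂ : ℝ) : ℂ)) •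
        modulation (A * y₂) (translation c f) := by
  apply Lp.ext
  filter_upwards [coeFn_weylHeisenberg A B c y₁ y₂ f, coeFn_translation c f,
    coeFn_modulation (A * y₂) (translation c f),
    Lp.coeFn_smul (Complex.exp (2 * Real.pi * Complex.I * ((A * y₁ + B * y₂ : ℝ) : ℂ)))
      (modulation (A * y₂) (translation c f))] with x h1 h2 h3 h4
  rw [h1, h4, Pi.smul_apply, h3, h2, smul_eq_mul, ← mul_assoc, ← Complex.exp_add]
  congr 2
  push_cast
  ring

theorem translation_modulation (a c : ℝ) (f : Lp ℂ 2 (volume : Measure ℝ)) :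
    translation c (modulation a f) =
      Complex.exp (2 * Real.pi * Complex.I * ((a * c : ℝ) : ℂ)) •
        modulation a (translation c f) := by
  apply Lp.ext
  filter_upwards [coeFn_translation c (modulation a f), coeFn_translation c f,
    ae_add_left (coeFn_modulation a f) c, coeFn_modulation a (translation c f),
    Lp.coeFn_smul (Complex.exp (2 * Real.pi * Complex.I * ((a * c : ℝ) : ℂ)))
      (modulation a (translation c f))] with x h1 h2 h3 h4 h5
  rw [h1, h3, h5, Pi.smul_apply, h4, h2, smul_eq_mul, ← mul_assoc, ← Complex.exp_add]
  congr 2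
  push_cast
  ring

/-- The Fourier transform of a Gabor system is, up to unimodular constants, the Gabor system of
the modulations by `n q_j` of the translates of the Fourier transforms of the generators. -/
theorem exists_fourier_gaborSystem {N : ℕ} (A B : ℝ) (p q : Fin N → ℝ)
    (Φ : Fin N → Lp ℂ 2 (volume : Measure ℝ)) (k : ℤ × ℤ × Fin N) :
    ∃ z : ℂ, ‖z‖ = 1 ∧ 𝓕 (gaborSystem A B p q Φ k) =
      z • modulation (k.1 * q k.2.2) (translation (-(A * k.2.1 * p k.2.2)) (𝓕 (Φ k.2.2))) := by
  have hnorm : ∀ r : ℝ, ‖Complex.exp (2 * Real.pi * Complex.I * (r : ℂ))‖ = 1 := fun r => by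
    rw [mul_right_comm, ← Complex.ofReal_ofNat, ← Complex.ofReal_mul,
      ← Complex.ofReal_mul, Complex.norm_exp_ofReal_mul_I]
  rw [gaborSystem, weylHeisenberg_eq, FourierTransform.fourier_smul, fourier_modulation,
    fourier_translation, translation_modulation, smul_smul, ← mul_assoc A]
  exact ⟨_, by rw [norm_mul, hnorm, hnorm, one_mul], rfl⟩

end WeylHeisenberg

/-! ### Fourier series as periodic multipliers -/

section PeriodicMultipliers

open Filter Topology

/-- The line is a countable union of periods, on each of which the quotient map preserves measure.
-/
theorem UnitAddCircle.ae_coe {P : UnitAddCircle → Prop}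
    (h : ∀ᵐ x ∂AddCircle.haarAddCircle, P x) :
    ∀ᵐ t : ℝ, P (t : UnitAddCircle) := by
  have hvol : (volume : Measure UnitAddCircle) = AddCircle.haarAddCircle := by
    rw [AddCircle.volume_eq_smul_haarAddCircle]; simp
  rw [← hvol] at h
  have h1 : ∀ n : ℤ, ∀ᵐ t : ℝ, t ∈ Set.Ioc (n : ℝ) (n + 1) → P (t : UnitAddCircle) := fun n =>
    (ae_restrict_iff' measurableSet_Ioc).1
      ((UnitAddCircle.measurePreserving_mk (n : ℝ)).quasiMeasurePreserving.ae h)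
  filter_upwards [ae_all_iff.2 h1] with t ht
  refine ht (⌈t⌉ - 1) ⟨?_, ?_⟩
  · push_cast; linarith [Int.ceil_lt_add_one t]
  · push_cast; linarith [Int.le_ceil t]

theorem UnitAddCircle.ae_coe_mul {P : UnitAddCircle → Prop}
    (h : ∀ᵐ x ∂AddCircle.haarAddCircle, P x) {q : ℝ} (hq : q ≠ 0) :
    ∀ᵐ t : ℝ, P ((q * t : ℝ) : UnitAddCircle) := by
  have hmap : Measure.QuasiMeasurePreserving (fun t : ℝ => q * t) volume volume := by
    refine ⟨measurable_const_mul q, ?_⟩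
    rw [Real.map_volume_mul_left hq]
    exact Measure.smul_absolutelyContinuous
  exact hmap.ae (UnitAddCircle.ae_coe h)

/-- If `G` is a square integrable function on the circle with Fourier coefficients `cₙ` and the
series `∑ₙ cₙ exp (2πi n q γ) ψ(γ)` converges in `L²(ℝ)`, then its sum is `G(q γ) ψ(γ)`. -/
theorem modulation_series_eq {q : ℝ} (hq : q ≠ 0) (ψ : Lp ℂ 2 (volume : Measure ℝ))
    (G : Lp ℂ 2 (AddCircle.haarAddCircle (T := 1))) {g : Lp ℂ 2 (volume : Measure ℝ)}
    (hg : HasSum (fun n : ℤ => fourierBasis.repr G n • modulation (n * q) ψ) g) :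
    g =ᵐ[volume] fun γ : ℝ => G ((q * γ : ℝ) : UnitAddCircle) * ψ γ := by
  have hG : HasSum (fun n : ℤ => fourierBasis.repr G n • fourierLp (T := 1) 2 n) G := by
    have := fourierBasis.hasSum_repr G
    rwa [coe_fourierBasis] at this
  set c := fourierBasis.repr G with hc
  -- `G` may be unbounded, so multiplication by it need not be continuous on `L²`. Instead both
  -- limits are compared pointwise: `u` makes the Fourier series converge a.e., and the subsequence
  -- `w` does the same for the series of `g`.
  obtain ⟨u, hu, hu'⟩ := (tendstoInMeasure_of_tendsto_Lp hG).exists_seq_tendsto_ae'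
  obtain ⟨w, hw, hw'⟩ :=
    (tendstoInMeasure_of_tendsto_Lp (Tendsto.comp hg hu)).exists_seq_tendsto_ae'
  have hpart : ∀ᵐ x : UnitAddCircle ∂AddCircle.haarAddCircle, ∀ i, (∑ n ∈ u i, c n • fourierLp (T := 1) 2 n :
      Lp ℂ 2 (AddCircle.haarAddCircle (T := 1))) x = ∑ n ∈ u i, c n * fourier n x := by
    have h1 : ∀ᵐ x : UnitAddCircle ∂AddCircle.haarAddCircle, ∀ n : ℤ,
        (c n • fourierLp (T := 1) 2 n : Lp ℂ 2 (AddCircle.haarAddCircle (T := 1))) x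
          = c n * fourier n x := by
      refine ae_all_iff.2 fun n => ?_
      filter_upwards [Lp.coeFn_smul (c n) (fourierLp (T := 1) 2 n), coeFn_fourierLp (T := 1) 2 n]
        with x h2 h3
      rw [h2, Pi.smul_apply, h3, smul_eq_mul]
    have h2 : ∀ᵐ x : UnitAddCircle ∂AddCircle.haarAddCircle, ∀ i,
        (∑ n ∈ u i, c n • fourierLp (T := 1) 2 n :
          Lp ℂ 2 (AddCircle.haarAddCircle (T := 1))) x = ∑ n ∈ u i,
          (c n • fourierLp (T := 1) 2 n : Lp ℂ 2 (AddCircle.haarAddCircle (T := 1))) x :=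
      ae_all_iff.2 fun i => by
        filter_upwards [Lp.coeFn_finsetSum (u i) fun n => c n • fourierLp (T := 1) 2 n] with x hx
        rw [hx, Finset.sum_apply]
    filter_upwards [h1, h2] with x h3 h4 i
    rw [h4]
    exact Finset.sum_congr rfl fun n _ => h3 n
  have hpart' : ∀ᵐ γ : ℝ, ∀ i, (∑ n ∈ u i, c n • modulation (n * q) ψ :
      Lp ℂ 2 (volume : Measure ℝ)) γ =
        (∑ n ∈ u i, c n * fourier n ((q * γ : ℝ) : UnitAddCircle)) * ψ γ := by
    have h1 : ∀ᵐ γ : ℝ, ∀ n : ℤ, (c n • modulation (n * q) ψ : Lp ℂ 2 (volume : Measure ℝ)) γ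
        = c n * fourier n ((q * γ : ℝ) : UnitAddCircle) * ψ γ := by
      refine ae_all_iff.2 fun n => ?_
      filter_upwards [Lp.coeFn_smul (c n) (modulation (n * q) ψ), coeFn_modulation (n * q) ψ]
        with γ h2 h3
      rw [h2, Pi.smul_apply, h3, smul_eq_mul, ← mul_assoc, fourier_coe_apply]
      congr 3
      push_cast
      ring
    have h2 : ∀ᵐ γ : ℝ, ∀ i, (∑ n ∈ u i, c n • modulation (n * q) ψ :
        Lp ℂ 2 (volume : Measure ℝ)) γ =
          ∑ n ∈ u i, (c n • modulation (n * q) ψ : Lp ℂ 2 (volume : Measure ℝ)) γ :=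
      ae_all_iff.2 fun i => by
        filter_upwards [Lp.coeFn_finsetSum (u i) fun n => c n • modulation (n * q) ψ] with x hx
        rw [hx, Finset.sum_apply]
    filter_upwards [h1, h2] with x h3 h4 i
    rw [h4, Finset.sum_mul]
    exact Finset.sum_congr rfl fun n _ => h3 n
  filter_upwards [hpart', hw', UnitAddCircle.ae_coe_mul hpart hq,
    UnitAddCircle.ae_coe_mul hu' hq] with γ h1 h2 h3 h4
  have h5 := (h4.comp hw).mul_const (ψ γ)
  refine tendsto_nhds_unique h2 (h5.congr fun i => ?_)
  simp only [Function.comp_apply]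
  rw [h1, h3]

end PeriodicMultipliers

/-! ### The closed span of the Gabor system on the Fourier side -/

section GaborSpan

open Filter Topology

theorem memLp_comp_coe (G : Lp ℂ 2 (AddCircle.haarAddCircle (T := 1))) :
    MemLp (fun t : ℝ => G (t : UnitAddCircle)) 2 (volume.restrict (Set.Ico (0 : ℝ) 1)) := by
  have h := ((memLp_haarAddCircle_iff.1 (Lp.memLp G)).comp_measurePreserving
    (UnitAddCircle.measurePreserving_mk 0))
  rw [zero_add, ← Measure.restrict_congr_set (Ico_ae_eq_Ioc (μ := volume))] at h
  exact h

/-- A `1`-periodic function that is square integrable over a period is a square integrable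
function on the circle. -/
theorem exists_lp_circle {F : ℝ → ℂ} (hF : Function.Periodic F 1)
    (hF2 : MemLp F 2 (volume.restrict (Set.Ico (0 : ℝ) 1))) {q : ℝ} (hq : q ≠ 0) :
    ∃ G : Lp ℂ 2 (AddCircle.haarAddCircle (T := 1)),
      ∀ᵐ γ : ℝ, G ((q * γ : ℝ) : UnitAddCircle) = F (q * γ) := by
  have hF2' : MemLp F 2 (volume.restrict (Set.Ioc (0 : ℝ) (0 + 1))) := by
    rw [zero_add, ← Measure.restrict_congr_set (Ico_ae_eq_Ioc (μ := volume))]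
    exact hF2
  have hlift : MemLp (AddCircle.liftIoc 1 0 F) 2 AddCircle.haarAddCircle :=
    memLp_haarAddCircle_iff.2 hF2'.memLp_liftIoc
  refine ⟨hlift.toLp _, ?_⟩
  have hcoe : ∀ t : ℝ, AddCircle.liftIoc 1 0 F (t : UnitAddCircle) = F t := fun t => by
    obtain ⟨s, hs, hst⟩ := (AddCircle.coe_image_Ioc_eq (1 : ℝ) 0).symm.subset
      (Set.mem_univ (t : UnitAddCircle))
    rw [← hst, AddCircle.liftIoc_coe_apply hs, ← hF.lift_coe s, ← hF.lift_coe t]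
    exact congrArg _ hst
  filter_upwards [UnitAddCircle.ae_coe_mul hlift.coeFn_toLp hq] with γ h
  rw [h, hcoe]

/-- If `q j = 0`, the vectors with `l = 0` all equal `Φ j`, a nonzero vector repeated infinitely
often. Nonvanishing makes `γ ↦ q j * γ` pull null sets back to null sets. -/
theorem IsFrameSequence.gaborSystem_step_ne_zero {N : ℕ} {A B : ℝ} {p q : Fin N → ℝ}
    {Φ : Fin N → Lp ℂ 2 (volume : Measure ℝ)} (hΦ : ∀ j, Φ j ≠ 0)
    (hframe : IsFrameSequence (gaborSystem A B p q Φ)) (j : Fin N) : q j ≠ 0 := by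
  intro hq
  have h0 : gaborSystem A B p q Φ (0, 0, j) = 0 := by
    refine hframe.eq_zero_of_constant (e := fun n : ℕ => ((n : ℤ), (0 : ℤ), j)) ?_ fun n => ?_
    · intro a b h
      simpa using h
    · simp [gaborSystem, hq]
  refine hΦ j (Lp.ext ?_)
  have h1 := coeFn_weylHeisenberg A B 0 0 0 (Φ j)
  have h2 : weylHeisenberg A B 0 0 0 (Φ j) = 0 := by simpa [gaborSystem] using h0
  rw [h2] at h1
  filter_upwards [h1] with x h3
  rw [h3]
  simp

/-- The multiples by periodic functions of the translates of the Fourier transforms of the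
generators are Fourier transforms of elements of the closed linear span. -/
theorem exists_mem_closedSpan_fourier {N : ℕ} {A B : ℝ} {p q : Fin N → ℝ}
    {Φ : Fin N → Lp ℂ 2 (volume : Measure ℝ)} (hq : ∀ j, q j ≠ 0)
    (hframe : IsFrameSequence (gaborSystem A B p q Φ)) (l : ℤ) (j : Fin N)
    (G : Lp ℂ 2 (AddCircle.haarAddCircle (T := 1))) :
    ∃ g ∈ closedSpan (gaborSystem A B p q Φ),
      (𝓕 g : Lp ℂ 2 (volume : Measure ℝ)) =ᵐ[volume] fun γ : ℝ =>
      G ((q j * γ : ℝ) : UnitAddCircle) * 𝓕 (Φ j) (γ - A * l * p j) := by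
  choose z hz hz' using exists_fourier_gaborSystem A B p q Φ
  have hz0 : ∀ k, z k ≠ 0 := fun k => by rw [← norm_ne_zero_iff, hz]; exact one_ne_zero
  let e : ℤ → ℤ × ℤ × Fin N := fun n => (n, l, j)
  have he : Function.Injective e := fun a b h => (Prod.ext_iff.1 h).1
  -- The inverse phases cancel those of the Fourier transform and do not change absolute values.
  have hd : Memℓp (fun n => fourierBasis.repr G n * (z (e n))⁻¹) 2 := by
    have := lp.memℓp (fourierBasis.repr G)
    rw [memℓp_gen_iff (by simp)] at this ⊢
    simpa [hz] using this
  obtain ⟨g, hg, hsum⟩ := hframe.exists_hasSum_comp_injective he hd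
  refine ⟨g, hg, ?_⟩
  have h := hsum.mapL (Lp.fourierTransformₗᵢ ℝ ℂ).toContinuousLinearEquiv.toContinuousLinearMap
  have h' : HasSum (fun n : ℤ => fourierBasis.repr G n •
      modulation (n * q j) (translation (-(A * l * p j)) (𝓕 (Φ j)))) (𝓕 g) := by
    convert! h using 2 with n
    rw [map_smul]
    change _ = _ • 𝓕 (gaborSystem A B p q Φ (e n))
    rw [hz', smul_smul, inv_mul_cancel_right₀ (hz0 _)]
  filter_upwards [modulation_series_eq (hq j) _ G h',
    coeFn_translation (-(A * l * p j)) (𝓕 (Φ j))] with γ h1 h2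
  rw [h1, h2, neg_add_eq_sub]

/-- For fixed `l, j`, the synthesis coefficients times the phases are square summable in `n`, hence
are the Fourier coefficients of some `G l j` by Riesz–Fischer. The index `((j, l), n)` prepares
summation over `n`, then `l`, then `j`. -/
theorem exists_hasSum_fourier_of_mem_closedSpan {N : ℕ} {A B : ℝ} {p q : Fin N → ℝ}
    {Φ : Fin N → Lp ℂ 2 (volume : Measure ℝ)}
    (hframe : IsFrameSequence (gaborSystem A B p q Φ)) {f : Lp ℂ 2 (volume : Measure ℝ)}
    (hf : f ∈ closedSpan (gaborSystem A B p q Φ)) :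
    ∃ G : ℤ → Fin N → Lp ℂ 2 (AddCircle.haarAddCircle (T := 1)),
      HasSum (fun i : (Fin N × ℤ) × ℤ => fourierBasis.repr (G i.1.2 i.1.1) i.2 •
        modulation (i.2 * q i.1.1) (translation (-(A * i.1.2 * p i.1.1)) (𝓕 (Φ i.1.1))))
        (𝓕 f) := by
  classical
  choose z hz hz' using exists_fourier_gaborSystem A B p q Φ
  obtain ⟨T, hT, hspan⟩ := hframe.exists_synthesis_operator
  obtain ⟨c, rfl⟩ := (hspan f).1 hf
  have hd : ∀ l j, Memℓp (fun n : ℤ => c (n, l, j) * z (n, l, j)) 2 := fun l j => by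
    have := lp.memℓp c
    rw [memℓp_gen_iff (by simp)] at this ⊢
    have he : Function.Injective fun n : ℤ => (n, l, j) := fun a b h => (Prod.ext_iff.1 h).1
    simpa [hz, Function.comp_def] using this.comp_injective he
  refine ⟨fun l j => fourierBasis.repr.symm ⟨_, hd l j⟩, ?_⟩
  let σ : (Fin N × ℤ) × ℤ ≃ ℤ × ℤ × Fin N :=
    (Equiv.prodComm _ _).trans (Equiv.prodCongr (Equiv.refl _) (Equiv.prodComm _ _))
  have h := (hasSum_synthesis hT c).mapL
    (Lp.fourierTransformₗᵢ ℝ ℂ).toContinuousLinearEquiv.toContinuousLinearMap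
  refine (σ.hasSum_iff.2 h).congr_fun ?_
  rintro ⟨⟨j, l⟩, n⟩
  rw [Function.comp_apply, map_smul, LinearIsometryEquiv.apply_symm_apply]
  change (c (n, l, j) * z (n, l, j)) • _ = c (n, l, j) • 𝓕 (gaborSystem A B p q Φ (n, l, j))
  rw [hz', smul_smul]

/-- Every element of the closed linear span is a series of multiples by periodic functions of the
translates of the Fourier transforms of the generators. -/
theorem exists_periodic_expansion {N : ℕ} {A B : ℝ} {p q : Fin N → ℝ}
    {Φ : Fin N → Lp ℂ 2 (volume : Measure ℝ)} (hq : ∀ j, q j ≠ 0)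
    (hframe : IsFrameSequence (gaborSystem A B p q Φ)) {f : Lp ℂ 2 (volume : Measure ℝ)}
    (hf : f ∈ closedSpan (gaborSystem A B p q Φ)) :
    ∃ (G : ℤ → Fin N → Lp ℂ 2 (AddCircle.haarAddCircle (T := 1)))
      (v : Fin N × ℤ → Lp ℂ 2 (volume : Measure ℝ)), HasSum v (𝓕 f) ∧
      ∀ j l, v (j, l) =ᵐ[volume] fun γ : ℝ =>
        G l j ((q j * γ : ℝ) : UnitAddCircle) * 𝓕 (Φ j) (γ - A * l * p j) := by
  obtain ⟨G, hG⟩ := exists_hasSum_fourier_of_mem_closedSpan hframe hf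
  choose v hv using fun i => hG.summable.prod_factor i
  refine ⟨G, v, hG.prod_fiberwise hv, fun j l => ?_⟩
  have h : HasSum (fun n : ℤ => fourierBasis.repr (G l j) n •
      modulation (n * q j) (translation (-(A * l * p j)) (𝓕 (Φ j)))) (v (j, l)) := hv (j, l)
  filter_upwards [modulation_series_eq (hq j) _ (G l j) h, coeFn_translation (-(A * l * p j)) (𝓕 (Φ j))] with γ h1 h2
  rw [h1, h2, neg_add_eq_sub]

end GaborSpan

theorem theorem3p8 (N : ℕ) (hN : 0 < N) (A B : ℝ) (hA : A ≠ 0) (p q : Fin N → ℝ)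
    (hpq : ∀ j, |p j * q j| < 1) (Φ : Fin N → Lp ℂ 2 (volume : Measure ℝ))
    (hΦ : ∀ j, Φ j ≠ 0) (hframe : IsFrameSequence (gaborSystem A B p q Φ))
    (f : Lp ℂ 2 (volume : Measure ℝ)) :
    f ∈ closedSpan (gaborSystem A B p q Φ) ↔
      ∃ F : ℤ → Fin N → ℝ → ℂ,
        (∀ l j, Function.Periodic (F l j) 1) ∧
        (∀ l j, MemLp (F l j) 2 (volume.restrict (Set.Ico (0 : ℝ) 1))) ∧
        ∃ g : Fin N → Lp ℂ 2 (volume : Measure ℝ),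
          (∀ j, HasL2Sum
            (fun (l : ℤ) (γ : ℝ) => F l j (q j * γ) * (𝓕 (Φ j)) (γ - A * l * p j)) (g j)) ∧
          𝓕 f = ∑ j, g j := by
  have hq := hframe.gaborSystem_step_ne_zero hΦ
  constructor
  · intro hf
    obtain ⟨G, v, hv, hvG⟩ := exists_periodic_expansion hq hframe hf
    choose g hg using fun j => hv.summable.prod_factor j
    refine ⟨fun l j t => G l j (t : UnitAddCircle), fun l j t => ?_,
      fun l j => memLp_comp_coe (G l j), g, fun j => ⟨fun l => v (j, l), hvG j, hg j⟩,
      (hv.prod_fiberwise hg).unique (hasSum_fintype g)⟩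
    simp only [AddCircle.coe_add_period]
  · rintro ⟨F, hper, hF, g, hg, hfg⟩
    refine (Lp.fourierTransformₗᵢ ℝ ℂ).mem_of_apply_eq_sum_of_hasSum (ι := ℤ)
      (Submodule.isClosed_topologicalClosure _) hfg fun j => ?_
    obtain ⟨v, hv, hsum⟩ := hg j
    refine ⟨v, fun l => ?_, hsum⟩
    obtain ⟨G, hG⟩ := exists_lp_circle (hper l j) (hF l j) (hq j)
    obtain ⟨h, hh, hhG⟩ := exists_mem_closedSpan_fourier hq hframe l j G
    refine ⟨h, hh, Lp.ext ?_⟩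
    filter_upwards [hv l, hhG, hG] with γ h1 h2 h3
    exact h2.trans (by rw [h1, h3])
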